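/- Let $(M,\omega)$ be a connected symplectic manifold and let $\mathcal G=\mathrm{SO}(2)\ltimes\mathbb R^3\times \mathrm{SO}(2)$, with elements $(\phi,a,\theta)$ and product $(\phi_1,a_1,\theta_1)(\phi_2,a_2,\theta_2)=(\phi_1+\phi_2,\;a_1+\exp(\phi_1\hat e_3)a_2,\;\theta_1+\theta_2)$, where $\exp(\phi\hat e_3)$ is the rotation of $\mathbb R^3$ by $\phi$ about $e_3$. Suppose that $\mathcal G$ acts on $M$ smoothly, symplectically, properly and faithfully, with a globally defined, coadjoint-equivariant momentum map $J=(J^\phi,J^a,J^\theta):M\to\mathfrak g^*$, that is, $\omega(\xi x,v)=\mathrm dJ_\xi(x)v$ and $J(gx)=(\mathrm{Ad}_g^*)^{-1}J(x)$. Let $H:M\to\mathbb R$ be a smooth $\mathcal G$-invariant function, with Hamiltonian vector field $f_H$ given by $\omega(f_H,v)=\mathrm dH(v)$. Let $x_e$ be a relative equilibrium of $\dot x=f_H(x)$ (that is, $t\mapsto\exp(t\xi)x_e$ is a solution for some $\xi\in\mathfrak g$) whose isotropy group is the diagonal subgroup $\mathrm{SO}(2)_D=\{(\phi,0,\phi)\}$.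 Write $\dim M=8+2k$ and $W=\mathbb R^{2k}$, with elements $w=(q,p)$, the standard symplectic form $dq\wedge dp$ and the standard structure matrix $\mathbb J$. Let $(a,\theta,\nu,w)$, with $\nu=(\nu^a,\nu^\theta)=(J^a,J^\theta)$, be coordinates on a $\mathcal G$-invariant open neighbourhood $U$ of $x_e$, with values $a\in\mathbb R^3$, $\theta\in\mathbb R/2\pi\mathbb Z$, $\nu\in\mathbb R^3\times\mathbb R$, $w\in W$, such that (i) they map $U$ diffeomorphically onto the set of all $(a,\theta,\nu,w)$ with $(\nu,w)\in V$, for some open $V\subseteq(\mathbb R^3\times\mathbb R)\times W$; (ii) they are canonical, $\omega=da\wedge d\nu^a+d\theta\wedge d\nu^\theta+dq\wedge dp$; (iii) $a=0$, $\theta=0$, $w=0$ at $x_e$. Put $W_\nu=\{w\in W:(\nu,w)\in V\}$. Let $R_\phi(\nu,w)$ be the $w$-coordinate of the image under $(\phi,0,\phi)\in\mathrm{SO}(2)_D$ of the point with coordinates $(0,0,\nu,w)$; let $H(\nu,w)$ be the value of $H$, and $J_W(\nu,w)$ the value of $J^{\mathrm{SO}(2)_D}:=J^\phi+J^\theta$,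 at the point with coordinates $(0,0,\nu,w)$. The reduced system at momentum $\nu$ is $\dot w=\mathbb J\,D_wH(\nu,w)$ on $W_\nu$. Proposition. Let $\nu$ be vertical, i.e. $\nu^a$ is a real multiple of $e_3$. Then: 1. $R_\phi(\nu,\cdot)$ is a smooth action of $\mathrm{SO}(2)_D$ on the open set $W_\nu$, and it is the action induced from $M$: for all $a,\theta$ and all $w\in W_\nu$, the element $(\phi,0,\phi)$ maps the point with coordinates $(a,\theta,\nu,w)$ to a point whose $\nu$- and $w$-coordinates are $\nu$ and $R_\phi(\nu,w)$. 2. This action is symplectic for $dq\wedge dp$, and $J_W(\nu,\cdot)$ is a momentum map for it: $(dq\wedge dp)\bigl(\tfrac{d}{d\phi}\big|_{\phi=0}R_\phi(\nu,w),v\bigr)=D_wJ_W(\nu,w)v$ for all $w\in W_\nu$ and $v\in W$. 3. The reduced system at $\nu$ is $\mathrm{SO}(2)_D$-symmetric: $H(\nu,R_\phi(\nu,w))=H(\nu,w)$, its vector field is equivariant under $R_\phi(\nu,\cdot)$, and $R_\phi(\nu,\cdot)$ maps solutions to solutions. 4. The reduced system at $\nu$ conserves $J_W$: $J_W(\nu,w(t))$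 is constant along each of its solutions $w(t)$ on an interval. -/

import Mathlib

open Set
open scoped Manifold ContDiff Topology

noncomputable section

/-- Euclidean three-space. -/
abbrev E3 : Type := EuclideanSpace ℝ (Fin 3)

/-- The vertical unit vector. -/
def e3 : E3 := !₂[0, 0, 1]

/-- The rotation `exp(φ ê₃)` of three-space by the angle `φ` about the vertical axis. -/
def rot (φ : Real.Angle) : E3 →ₗ[ℝ] E3 where
  toFun v := !₂[φ.cos * v 0 - φ.sin * v 1, φ.sin * v 0 + φ.cos * v 1, v 2]
  map_add' u v := by ext i; fin_cases i <;> simp <;> ring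
  map_smul' c v := by ext i; fin_cases i <;> simp <;> ring

/-- The generator `v ↦ e₃ × v` of the rotations about the vertical axis. -/
def crossE3 (v : E3) : E3 := !₂[-v 1, v 0, 0]

/-- The group `SO(2) ⋉ ℝ³ × SO(2)`, with elements `(φ, a, θ)`; `SO(2)` is `ℝ / 2πℤ`. -/
@[ext] structure SymGroup : Type where
  rotation : Real.Angle
  translation : E3
  spin : Real.Angle

namespace SymGroup

theorem rot_zero (v : E3) : rot 0 v = v := by
  ext i; fin_cases i <;> simp [rot]

theorem rot_rot (φ ψ : Real.Angle) (v : E3) : rot φ (rot ψ v) = rot (φ + ψ) v := by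
  ext i
  fin_cases i <;> simp [rot, Real.Angle.cos_add, Real.Angle.sin_add] <;> ring

/-- The product `(φ₁ + φ₂, a₁ + exp(φ₁ ê₃) a₂, θ₁ + θ₂)`. -/
instance : Mul SymGroup :=
  ⟨fun g h => ⟨g.rotation + h.rotation, g.translation + rot g.rotation h.translation,
    g.spin + h.spin⟩⟩

instance : One SymGroup := ⟨⟨0, 0, 0⟩⟩

instance : Inv SymGroup := ⟨fun g => ⟨-g.rotation, -rot (-g.rotation) g.translation, -g.spin⟩⟩

theorem mul_def (g h : SymGroup) : g * h = ⟨g.rotation + h.rotation,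
    g.translation + rot g.rotation h.translation, g.spin + h.spin⟩ := rfl

theorem one_def : (1 : SymGroup) = ⟨0, 0, 0⟩ := rfl

theorem inv_def (g : SymGroup) :
    g⁻¹ = ⟨-g.rotation, -rot (-g.rotation) g.translation, -g.spin⟩ := rfl

instance : Group SymGroup :=
  Group.ofLeftAxioms
    (fun g h k => by simp [mul_def, add_assoc, rot_rot])
    (fun g => by simp [mul_def, one_def, rot_zero])
    (fun g => by simp [mul_def, one_def, inv_def])

/-- The topology of the product `SO(2) × ℝ³ × SO(2)`. -/
instance : TopologicalSpace SymGroup :=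
  TopologicalSpace.induced (fun g => (g.rotation, g.translation, g.spin)) inferInstance

/-- The element `(φ, 0, φ)` of the diagonal subgroup `SO(2)_D`. -/
def diag (φ : Real.Angle) : SymGroup := ⟨φ, 0, φ⟩

end SymGroup

/-- The Lie algebra `so(2) ⋉ ℝ³ × so(2)`, with elements `(ξ^φ, ξ^a, ξ^θ)`. -/
abbrev SymLie : Type := ℝ × E3 × ℝ

namespace SymLie

/-- The exponential map of the group: the time one value of the one-parameter subgroup
with velocity `ξ` at the identity. -/
def exp (ξ : SymLie) : SymGroup :=
  ⟨(ξ.1 : Real.Angle), ∫ s in (0 : ℝ)..1, rot ((s * ξ.1 : ℝ) : Real.Angle) ξ.2.1,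
    (ξ.2.2 : Real.Angle)⟩

/-- The adjoint action `Ad_g ξ = g ξ g⁻¹`. -/
def Ad (g : SymGroup) : SymLie →ₗ[ℝ] SymLie where
  toFun ξ := (ξ.1, rot g.rotation ξ.2.1 - ξ.1 • crossE3 g.translation, ξ.2.2)
  map_add' ξ η := by
    ext i
    · simp
    · simp; ring
    · simp
  map_smul' c ξ := by
    ext i
    · simp
    · simp; ring
    · simp

/-- The map `Ad_g^*` on the dual of the Lie algebra: `(Ad_g^* μ)(ξ) = μ (Ad_g ξ)`. -/
def coAd (g : SymGroup) (μ : Module.Dual ℝ SymLie) : Module.Dual ℝ SymLie := μ ∘ₗ Ad g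

end SymLie

section Symplectic

variable {E : Type*} [NormedAddCommGroup E] [NormedSpace ℝ E]
  {M : Type*} [TopologicalSpace M] [ChartedSpace E M]

/-- The expression in the preferred chart at `x₀` of a field of alternating 2-forms. -/
def chartForm (Ω : ∀ x : M, TangentSpace 𝓘(ℝ, E) x [⋀^Fin 2]→L[ℝ] ℝ) (x₀ : M) :
    E → E [⋀^Fin 2]→L[ℝ] ℝ :=
  fun y => (Ω ((extChartAt 𝓘(ℝ, E) x₀).symm y)).compContinuousLinearMap
    (mfderiv 𝓘(ℝ, E) 𝓘(ℝ, E) (extChartAt 𝓘(ℝ, E) x₀).symm y)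

/-- A symplectic form on `M`: a smooth, closed, nondegenerate 2-form. -/
structure IsSymplecticForm (Ω : ∀ x : M, TangentSpace 𝓘(ℝ, E) x [⋀^Fin 2]→L[ℝ] ℝ) :
    Prop where
  smooth : ∀ x₀ : M, ContDiffOn ℝ ∞ (chartForm Ω x₀) (extChartAt 𝓘(ℝ, E) x₀).target
  closed : ∀ x₀ : M, ∀ y ∈ (extChartAt 𝓘(ℝ, E) x₀).target, extDeriv (chartForm Ω x₀) y = 0
  nondegenerate : ∀ (x : M) (u : TangentSpace 𝓘(ℝ, E) x),
    (∀ v : TangentSpace 𝓘(ℝ, E) x, Ω x ![u, v] = 0) → u = 0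

/-- `γ` is a solution, for all times, of the Hamiltonian system `ẋ = f_H(x)`, where
`Ω(f_H, v) = dH(v)` for all tangent vectors `v`. -/
def IsHamiltonianSolution (Ω : ∀ x : M, TangentSpace 𝓘(ℝ, E) x [⋀^Fin 2]→L[ℝ] ℝ)
    (H : M → ℝ) (γ : ℝ → M) : Prop :=
  ∀ t : ℝ, MDifferentiableAt 𝓘(ℝ, ℝ) 𝓘(ℝ, E) γ t ∧
    ∀ v : TangentSpace 𝓘(ℝ, E) (γ t),
      Ω (γ t) ![mfderiv 𝓘(ℝ, ℝ) 𝓘(ℝ, E) γ t (1 : ℝ), v] = mfderiv 𝓘(ℝ, E) 𝓘(ℝ, ℝ) H (γ t) v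

variable [MulAction SymGroup M]

/-- The action of the Lie group on `M` is smooth. The angles are lifted to `ℝ`, which is
harmless because `ℝ → ℝ / 2πℤ` is a local diffeomorphism. -/
def IsSmoothAction (E : Type*) [NormedAddCommGroup E] [NormedSpace ℝ E]
    (M : Type*) [TopologicalSpace M] [ChartedSpace E M] [MulAction SymGroup M] : Prop :=
  ContMDiff (𝓘(ℝ, ℝ × E3 × ℝ).prod 𝓘(ℝ, E)) 𝓘(ℝ, E) ∞
    (fun p : (ℝ × E3 × ℝ) × M => (⟨p.1.1, p.1.2.1, p.1.2.2⟩ : SymGroup) • p.2)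

/-- Every group element preserves the form `Ω`. -/
def PreservesForm (Ω : ∀ x : M, TangentSpace 𝓘(ℝ, E) x [⋀^Fin 2]→L[ℝ] ℝ) : Prop :=
  ∀ (g : SymGroup) (x : M) (u v : TangentSpace 𝓘(ℝ, E) x),
    Ω (g • x) ![mfderiv 𝓘(ℝ, E) 𝓘(ℝ, E) (fun y : M => g • y) x u,
      mfderiv 𝓘(ℝ, E) 𝓘(ℝ, E) (fun y : M => g • y) x v] = Ω x ![u, v]

/-- The infinitesimal generator `ξ x`, the velocity of `exp(t ξ) x` at `t = 0`. -/
def generator (ξ : SymLie) (x : M) : TangentSpace 𝓘(ℝ, E) x :=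
  (mfderiv 𝓘(ℝ, ℝ) 𝓘(ℝ, E) (fun t : ℝ => SymLie.exp (t • ξ) • x) 0 (1 : ℝ) : E)

/-- `J` is a smooth momentum map, `Ω(ξ x, v) = dJ_ξ(x) v`, and it is coadjoint
equivariant, `J(g x) = (Ad_g^*)⁻¹ J(x)` (note `(Ad_g^*)⁻¹ = Ad_{g⁻¹}^*`). -/
structure IsEquivariantMomentumMap
    (Ω : ∀ x : M, TangentSpace 𝓘(ℝ, E) x [⋀^Fin 2]→L[ℝ] ℝ)
    (J : M → Module.Dual ℝ SymLie) : Prop where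
  smooth : ∀ ξ : SymLie, ContMDiff 𝓘(ℝ, E) 𝓘(ℝ, ℝ) ∞ (fun x => J x ξ)
  momentum : ∀ (ξ : SymLie) (x : M) (v : TangentSpace 𝓘(ℝ, E) x),
    Ω x ![generator ξ x, v] = mfderiv 𝓘(ℝ, E) 𝓘(ℝ, ℝ) (fun y => J y ξ) x v
  equivariant : ∀ (g : SymGroup) (x : M), J (g • x) = SymLie.coAd g⁻¹ (J x)

/-- `x` is a relative equilibrium: `exp(t ξ) x` is a solution for some `ξ`. -/
def IsRelativeEquilibrium (Ω : ∀ x : M, TangentSpace 𝓘(ℝ, E) x [⋀^Fin 2]→L[ℝ] ℝ)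
    (H : M → ℝ) (x : M) : Prop :=
  ∃ ξ : SymLie, IsHamiltonianSolution Ω H (fun t : ℝ => SymLie.exp (t • ξ) • x)

/-- `x` is axisymmetric: its isotropy group is the diagonal subgroup `SO(2)_D`. -/
def IsAxisymmetric (x : M) : Prop :=
  (MulAction.stabilizer SymGroup x : Set SymGroup) = Set.range SymGroup.diag

end Symplectic

section Momenta

variable {M : Type*} (J : M → Module.Dual ℝ SymLie)

/-- The component `J^φ`. -/
def Jrotation (x : M) : ℝ := J x (1, 0, 0)

/-- The component `J^a`, as a vector of `ℝ³`. -/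
def Jtranslation (x : M) : E3 :=
  WithLp.toLp 2 (fun i => J x (0, EuclideanSpace.single i 1, 0))

/-- The component `J^θ`. -/
def Jspin (x : M) : ℝ := J x (0, 0, 1)

/-- `J^{SO(2)_D} = J^φ + J^θ`. -/
def Jdiag (x : M) : ℝ := Jrotation J x + Jspin J x

end Momenta

/-- The momenta `ν = (ν^a, ν^θ)` of the abelian subgroup `ℝ³ × SO(2)_R`. -/
abbrev Momenta : Type := E3 × ℝ

/-- `ν` is vertical: `ν^a` is parallel to `e₃`. -/
def IsVertical (ν : Momenta) : Prop := ∃ c : ℝ, ν.1 = c • e3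

/-- The linear symplectic space `W = ℝ^{2k}`, with elements `w = (q, p)`. -/
abbrev WSpace (k : ℕ) : Type := EuclideanSpace ℝ (Fin k) × EuclideanSpace ℝ (Fin k)

/-- The standard symplectic form `dq ∧ dp` of `W`. -/
def formW {k : ℕ} (u v : WSpace k) : ℝ := inner ℝ u.1 v.2 - inner ℝ u.2 v.1

/-- The standard structure matrix `𝕁` applied to a covector: `𝕁 (α, β) = (β, -α)`. -/
def structJ {k : ℕ} (l : WSpace k →L[ℝ] ℝ) : WSpace k :=
  (WithLp.toLp 2 (fun i => l (0, EuclideanSpace.single i 1)),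
    WithLp.toLp 2 (fun i => -l (EuclideanSpace.single i 1, 0)))

/-- Coordinate values `(a, θ, ν, w)`, with the angle `θ` lifted to `ℝ`. -/
abbrev CoordSpace (k : ℕ) : Type := E3 × ℝ × Momenta × WSpace k

/-- The canonical form `da ∧ dν^a + dθ ∧ dν^θ + dq ∧ dp`. -/
def canonicalForm {k : ℕ} (u v : CoordSpace k) : ℝ :=
  (inner ℝ u.1 v.2.2.1.1 - inner ℝ u.2.2.1.1 v.1)
    + (u.2.1 * v.2.2.1.2 - u.2.2.1.2 * v.2.1) + formW u.2.2.2 v.2.2.2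

/-- Canonical coordinates `(a, θ, ν, w)` on a neighbourhood `U` of `x_e` that is invariant
under the whole group, where `ν = (J^a, J^θ)`, the coordinate `θ` is an angle, and `x_e` is at
`a = 0`, `θ = 0`, `w = 0`. The coordinates map `U` diffeomorphically onto the set of
`(a, θ, ν, w)` with `(ν, w) ∈ V`; the inverse diffeomorphism is `point`. -/
structure ReductionCoordinates {E : Type*} [NormedAddCommGroup E] [NormedSpace ℝ E]
    {M : Type*} [TopologicalSpace M] [ChartedSpace E M] [MulAction SymGroup M]
    (Ω : ∀ x : M, TangentSpace 𝓘(ℝ, E) x [⋀^Fin 2]→L[ℝ] ℝ)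
    (J : M → Module.Dual ℝ SymLie) (xe : M) (k : ℕ) where
  U : Set M
  V : Set (Momenta × WSpace k)
  a : M → E3
  θ : M → Real.Angle
  w : M → WSpace k
  point : E3 → Real.Angle → Momenta → WSpace k → M
  isOpen_U : IsOpen U
  isOpen_V : IsOpen V
  smul_mem : ∀ (g : SymGroup), ∀ x ∈ U, g • x ∈ U
  xe_mem : xe ∈ U
  a_xe : a xe = 0
  θ_xe : θ xe = 0
  w_xe : w xe = 0
  mem_V : ∀ x ∈ U, ((Jtranslation J x, Jspin J x), w x) ∈ V
  point_coords : ∀ x ∈ U, point (a x) (θ x) (Jtranslation J x, Jspin J x) (w x) = x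
  point_mem : ∀ b ψ ν z, (ν, z) ∈ V → point b ψ ν z ∈ U
  a_point : ∀ b ψ ν z, (ν, z) ∈ V → a (point b ψ ν z) = b
  θ_point : ∀ b ψ ν z, (ν, z) ∈ V → θ (point b ψ ν z) = ψ
  ν_point : ∀ b ψ ν z, (ν, z) ∈ V →
    (Jtranslation J (point b ψ ν z), Jspin J (point b ψ ν z)) = ν
  w_point : ∀ b ψ ν z, (ν, z) ∈ V → w (point b ψ ν z) = z
  smooth_a : ContMDiffOn 𝓘(ℝ, E) 𝓘(ℝ, E3) ∞ a U
  smooth_cos_θ : ContMDiffOn 𝓘(ℝ, E) 𝓘(ℝ, ℝ) ∞ (fun x => (θ x).cos) U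
  smooth_sin_θ : ContMDiffOn 𝓘(ℝ, E) 𝓘(ℝ, ℝ) ∞ (fun x => (θ x).sin) U
  smooth_w : ContMDiffOn 𝓘(ℝ, E) 𝓘(ℝ, WSpace k) ∞ w U
  smooth_point : ContMDiffOn 𝓘(ℝ, CoordSpace k) 𝓘(ℝ, E) ∞
    (fun c : CoordSpace k => point c.1 (c.2.1 : Real.Angle) c.2.2.1 c.2.2.2)
    {c | c.2.2 ∈ V}
  canonical : ∀ c : CoordSpace k, c.2.2 ∈ V → ∀ u v : CoordSpace k,
    Ω (point c.1 (c.2.1 : Real.Angle) c.2.2.1 c.2.2.2)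
      ![mfderiv 𝓘(ℝ, CoordSpace k) 𝓘(ℝ, E)
          (fun c : CoordSpace k => point c.1 (c.2.1 : Real.Angle) c.2.2.1 c.2.2.2) c u,
        mfderiv 𝓘(ℝ, CoordSpace k) 𝓘(ℝ, E)
          (fun c : CoordSpace k => point c.1 (c.2.1 : Real.Angle) c.2.2.1 c.2.2.2) c v]
      = canonicalForm u v

namespace ReductionCoordinates

variable {E : Type*} [NormedAddCommGroup E] [NormedSpace ℝ E]
  {M : Type*} [TopologicalSpace M] [ChartedSpace E M] [MulAction SymGroup M]
  {Ω : ∀ x : M, TangentSpace 𝓘(ℝ, E) x [⋀^Fin 2]→L[ℝ] ℝ}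
  {J : M → Module.Dual ℝ SymLie} {xe : M} {k : ℕ}

/-- The part of `W` covered by the coordinates at the fixed momentum `ν`. -/
def leaf (C : ReductionCoordinates Ω J xe k) (ν : Momenta) : Set (WSpace k) :=
  {z | (ν, z) ∈ C.V}

/-- The `w`-component `R_φ(ν, w)` of the action of `(φ, 0, φ) ∈ SO(2)_D`. -/
def R (C : ReductionCoordinates Ω J xe k) (ν : Momenta) (φ : Real.Angle) (z : WSpace k) :
    WSpace k :=
  C.w (SymGroup.diag φ • C.point 0 0 ν z)

/-- The Hamiltonian `H(ν, w)`. -/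
def redH (C : ReductionCoordinates Ω J xe k) (H : M → ℝ) (ν : Momenta) (z : WSpace k) : ℝ :=
  H (C.point 0 0 ν z)

/-- `J_W(ν, w)`, the restriction of `J^φ + J^θ` to `a = 0`, `θ = 0`. -/
def JW (C : ReductionCoordinates Ω J xe k) (ν : Momenta) (z : WSpace k) : ℝ :=
  Jdiag J (C.point 0 0 ν z)

/-- The right-hand side of the reduced system `ẇ = 𝕁 D_w H(ν, w)`. -/
def redField (C : ReductionCoordinates Ω J xe k) (H : M → ℝ) (ν : Momenta) (z : WSpace k) :
    WSpace k :=
  structJ (fderiv ℝ (C.redH H ν) z)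

/-- `γ` solves the reduced system at momentum `ν` on the time interval `I`. -/
def IsReducedSolution (C : ReductionCoordinates Ω J xe k) (H : M → ℝ) (ν : Momenta)
    (I : Set ℝ) (γ : ℝ → WSpace k) : Prop :=
  ∀ t ∈ I, γ t ∈ C.leaf ν ∧ HasDerivWithinAt γ (C.redField H ν (γ t)) I t

end ReductionCoordinates

/-- `R` restricts to a smooth action of the circle group on the open set `S ⊆ W`. -/
structure IsCircleAction {k : ℕ} (S : Set (WSpace k))
    (R : Real.Angle → WSpace k → WSpace k) : Prop where
  isOpen : IsOpen S
  mapsTo : ∀ φ, MapsTo (R φ) S S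
  zero : ∀ z ∈ S, R 0 z = z
  add : ∀ φ ψ, ∀ z ∈ S, R (φ + ψ) z = R φ (R ψ z)
  smooth : ContDiffOn ℝ ∞ (fun p : ℝ × WSpace k => R (p.1 : Real.Angle) p.2)
    ((univ : Set ℝ) ×ˢ S)

/-- Every `R φ` preserves the symplectic form of `W` on `S`. -/
def IsSymplecticOn {k : ℕ} (S : Set (WSpace k))
    (R : Real.Angle → WSpace k → WSpace k) : Prop :=
  ∀ φ, ∀ z ∈ S, ∀ u v : WSpace k,
    formW (fderiv ℝ (R φ) z u) (fderiv ℝ (R φ) z v) = formW u v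

/-- `F` is a momentum map of the circle action `R` on `S`. -/
def IsCircleMomentumMap {k : ℕ} (S : Set (WSpace k))
    (R : Real.Angle → WSpace k → WSpace k) (F : WSpace k → ℝ) : Prop :=
  ContDiffOn ℝ ∞ F S ∧ ∀ z ∈ S, ∀ v : WSpace k,
    formW (deriv (fun t : ℝ => R (t : Real.Angle) z) 0) v = fderiv ℝ F z v

end

/-! The shifts `(0, b, ψ)` form a normal abelian subgroup with momentum `ν`, and the reduced system
is the quotient of a level of `ν` by them. In canonical coordinates the Hamiltonian field of `⟨b,
ν^a⟩ + ψ ν^θ` is `b ∂_a + ψ ∂_θ` (`generator_shift_lift`). Integrating it, the shifts translate `(a,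
θ)` and fix `w` (`coords_shift_smul`), so `w` labels the shift orbits in a level.

Coadjoint equivariance makes a group element rotate `ν^a`, so the diagonal subgroup preserves the
level of a vertical `ν`. It also normalizes the shifts, so it permutes their orbits: the
`w`-coordinate of the image does not depend on `a` and `θ` (`w_diag_smul_point`). Hence `R` is a
group action and the reduced Hamiltonian is invariant.

Every term of the canonical form except `dq ∧ dp` contains a differential of `ν`. On vectors tangent
to a level, `Ω` is therefore `dq ∧ dp` of their `w`-components (`form_eq_formW`). This turns
invariance of `Ω` into symplecticity of `R`, and the momentum identity on `M` into the one for
`J_W`. Equivariance of the reduced field and conservation of `J_W` are then the usual Hamiltonian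
arguments on `W`. -/

noncomputable section

/-! ### Chain rules through a manifold -/

section VectorValued

variable {E : Type*} [NormedAddCommGroup E] [NormedSpace ℝ E]
  {M : Type*} [TopologicalSpace M] [ChartedSpace E M]
  {X : Type*} [NormedAddCommGroup X] [NormedSpace ℝ X]
  {Y : Type*} [NormedAddCommGroup Y] [NormedSpace ℝ Y]

/-- The chain rule for a composition of maps between normed spaces through a manifold. -/
theorem HasFDerivAt.of_mdifferentiableAt_comp {G : M → Y} {F : X → M} {x : X}
    (hG : MDifferentiableAt 𝓘(ℝ, E) 𝓘(ℝ, Y) G (F x))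
    (hF : MDifferentiableAt 𝓘(ℝ, X) 𝓘(ℝ, E) F x) :
    HasFDerivAt (fun y => G (F y))
      ((mfderiv 𝓘(ℝ, E) 𝓘(ℝ, Y) G (F x) : E →L[ℝ] Y).comp
        (mfderiv 𝓘(ℝ, X) 𝓘(ℝ, E) F x : X →L[ℝ] E)) x :=
  hasMFDerivAt_iff_hasFDerivAt.1 (hG.hasMFDerivAt.comp x hF.hasMFDerivAt)

/-- The chain rule for a vector-valued map along a curve in a manifold. -/
theorem HasDerivAt.of_mdifferentiableAt_comp {G : M → Y} {γ : ℝ → M} {t : ℝ}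
    (hG : MDifferentiableAt 𝓘(ℝ, E) 𝓘(ℝ, Y) G (γ t))
    (hγ : MDifferentiableAt 𝓘(ℝ, ℝ) 𝓘(ℝ, E) γ t) :
    HasDerivAt (fun s => G (γ s))
      (mfderiv 𝓘(ℝ, E) 𝓘(ℝ, Y) G (γ t) (mfderiv 𝓘(ℝ, ℝ) 𝓘(ℝ, E) γ t (1 : ℝ)) : Y) t := by
  -- Naming the composite `L` gives it a type between normed spaces, free of tangent spaces.
  obtain ⟨L, hL, hL1⟩ : ∃ L : ℝ →L[ℝ] Y, HasFDerivAt (fun s => G (γ s)) L t ∧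
      L 1 = (mfderiv 𝓘(ℝ, E) 𝓘(ℝ, Y) G (γ t) (mfderiv 𝓘(ℝ, ℝ) 𝓘(ℝ, E) γ t (1 : ℝ)) : Y) :=
    ⟨_, HasFDerivAt.of_mdifferentiableAt_comp hG hγ, rfl⟩
  rw [← hL1]
  exact hL.hasDerivAt

end VectorValued

/-! ### Linear symplectic algebra of `W` and of the coordinate space -/

section Forms

variable {k : ℕ}

theorem formW_swap (u v : WSpace k) : formW u v = -formW v u := by
  rw [formW, formW, real_inner_comm u.1 v.2, real_inner_comm u.2 v.1]; ring

theorem formW_structJ (l : WSpace k →L[ℝ] ℝ) (v : WSpace k) : formW (structJ l) v = l v := by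
  have h : v = ∑ i, (v.1 i • ((EuclideanSpace.single i 1, 0) : WSpace k)
      + v.2 i • ((0, EuclideanSpace.single i 1) : WSpace k)) := by
    ext j <;> simp [Prod.fst_sum, Prod.snd_sum, Pi.single_apply]
  conv_rhs => rw [h]
  simp only [map_sum, map_add, map_smul, Finset.sum_add_distrib, smul_eq_mul]
  simp [formW, structJ, PiLp.inner_apply]
  ring

theorem formW_nondegenerate {u u' : WSpace k} (h : ∀ v, formW u v = formW u' v) : u = u' := by
  have h1 : ∀ v, inner ℝ u.1 v = inner ℝ u'.1 v := fun v => by simpa [formW] using h (0, v)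
  have h2 : ∀ v, inner ℝ u.2 v = inner ℝ u'.2 v := fun v => by simpa [formW] using h (v, 0)
  exact Prod.ext (ext_inner_right ℝ h1) (ext_inner_right ℝ h2)

/-- Each component of `u` is isolated by pairing with a vector along the conjugate component. -/
theorem canonicalForm_nondegenerate {u : CoordSpace k} (h : ∀ v, canonicalForm u v = 0) :
    u = 0 := by
  have h1 : ∀ v, inner ℝ u.1 v = inner ℝ (0 : E3) v := fun v => by
    simpa [canonicalForm, formW] using h (0, 0, (v, 0), 0)
  have h2 : ∀ v, inner ℝ u.2.2.1.1 v = inner ℝ (0 : E3) v := fun v => by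
    simpa [canonicalForm, formW] using h (v, 0, 0, 0)
  have h3 : u.2.1 = 0 := by simpa [canonicalForm, formW] using h (0, 0, (0, 1), 0)
  have h4 : u.2.2.1.2 = 0 := by simpa [canonicalForm, formW] using h (0, 1, 0, 0)
  have h5 : u.2.2.2 = 0 := formW_nondegenerate fun v => by
    have := h (0, 0, 0, v)
    simp only [canonicalForm] at this
    simpa [formW] using this
  refine Prod.ext (ext_inner_right ℝ h1) (Prod.ext h3 (Prod.ext (Prod.ext ?_ h4) h5))
  exact ext_inner_right ℝ h2

end Forms

/-! ### Shifts and the diagonal subgroup -/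

section Group

open SymGroup

theorem SymGroup.diag_add (φ ψ : Real.Angle) : diag (φ + ψ) = diag φ * diag ψ := by
  ext1 <;> simp [diag, mul_def]

theorem SymGroup.diag_zero : diag 0 = 1 := rfl

/-- The element `(0, b, ψ)` of the normal abelian subgroup `ℝ³ × SO(2)`. -/
def SymGroup.shift (b : E3) (ψ : Real.Angle) : SymGroup := ⟨0, b, ψ⟩

theorem SymGroup.shift_zero : shift 0 0 = 1 := rfl

theorem SymGroup.shift_mul_shift (b b' : E3) (ψ ψ' : Real.Angle) :
    shift b ψ * shift b' ψ' = shift (b + b') (ψ + ψ') := by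
  ext1 <;> simp [shift, mul_def, rot_zero]

/-- Normality of the shifts in explicit form; it lets the diagonal action descend to shift orbits.
-/
theorem SymGroup.diag_mul_shift (φ : Real.Angle) (b : E3) (ψ : Real.Angle) :
    diag φ * shift b ψ = shift (rot φ b) ψ * diag φ := by
  ext1 <;> simp [shift, diag, mul_def, rot_zero, add_comm]

theorem SymLie.exp_diag (t : ℝ) :
    SymLie.exp (t • ((1, 0, 1) : SymLie)) = diag (t : Real.Angle) := by
  ext1 <;> simp [SymLie.exp, diag]

theorem SymLie.exp_shift (t : ℝ) (b : E3) (ψ : ℝ) :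
    SymLie.exp (t • ((0, b, ψ) : SymLie)) = shift (t • b) ((t * ψ : ℝ) : Real.Angle) := by
  ext1 <;> simp [SymLie.exp, shift, rot_zero]

theorem rot_vertical (φ : Real.Angle) (c : ℝ) : rot φ (c • e3) = c • e3 := by
  ext i; fin_cases i <;> simp [rot, e3]

end Group

/-! ### Equivariance of the momenta `ν` -/

section Momenta

variable {M : Type*} (J : M → Module.Dual ℝ SymLie)

/-- The momenta `ν = (J^a, J^θ)`. -/
def shiftMomenta (x : M) : Momenta := (Jtranslation J x, Jspin J x)

theorem Jdiag_eq (x : M) : Jdiag J x = J x (1, 0, 1) := by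
  rw [Jdiag, Jrotation, Jspin, ← map_add]; simp

theorem dual_shift_eq (x : M) (b : E3) (ψ : ℝ) :
    J x (0, b, ψ) = inner ℝ b (shiftMomenta J x).1 + ψ * (shiftMomenta J x).2 := by
  have h : ((0, b, ψ) : SymLie) = ∑ i, b i • ((0, EuclideanSpace.single i 1, 0) : SymLie)
      + ψ • ((0, 0, 1) : SymLie) := by
    refine Prod.ext ?_ (Prod.ext ?_ ?_)
    · simp [Prod.fst_sum]
    · ext j; simp [Prod.fst_sum, Prod.snd_sum, Pi.single_apply]
    · simp [Prod.snd_sum]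
  rw [h]
  simp only [map_sum, map_add, map_smul, smul_eq_mul]
  simp [shiftMomenta, Jtranslation, Jspin, PiLp.inner_apply, mul_comm]

variable {J}
variable {E : Type*} [NormedAddCommGroup E] [NormedSpace ℝ E]
  [TopologicalSpace M] [ChartedSpace E M] [MulAction SymGroup M]
  {Ω : ∀ x : M, TangentSpace 𝓘(ℝ, E) x [⋀^Fin 2]→L[ℝ] ℝ}

namespace IsEquivariantMomentumMap

theorem contMDiff_shiftMomenta (hJ : IsEquivariantMomentumMap Ω J) :
    ContMDiff 𝓘(ℝ, E) 𝓘(ℝ, Momenta) ∞ (shiftMomenta J) := by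
  have h1 : ContMDiff 𝓘(ℝ, E) 𝓘(ℝ, Fin 3 → ℝ) ∞
      (fun x => fun i => J x (0, EuclideanSpace.single i 1, 0)) :=
    contMDiff_pi_space.2 fun i => hJ.smooth _
  exact ((PiLp.continuousLinearEquiv 2 ℝ (fun _ : Fin 3 => ℝ)).symm.contDiff.contMDiff.comp
    h1).prodMk_space (hJ.smooth (0, 0, 1))

theorem contMDiff_Jdiag (hJ : IsEquivariantMomentumMap Ω J) :
    ContMDiff 𝓘(ℝ, E) 𝓘(ℝ, ℝ) ∞ (Jdiag J) := by
  rw [show Jdiag J = fun x => J x (1, 0, 1) from funext (Jdiag_eq J)]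
  exact hJ.smooth _

/-- The rotations act on the momenta `ν = (ν^a, ν^θ)` by rotating `ν^a`. -/
theorem shiftMomenta_smul (hJ : IsEquivariantMomentumMap Ω J) (g : SymGroup) (x : M) :
    shiftMomenta J (g • x) = (rot g.rotation (shiftMomenta J x).1, (shiftMomenta J x).2) := by
  -- Without a rotational component in the Lie algebra element, the translation of `g` drops out of
  -- `Ad`.
  have key : ∀ (b : E3) (ψ : ℝ), J (g • x) (0, b, ψ) = J x (0, rot (-g.rotation) b, ψ) := by
    intro b ψ
    rw [hJ.equivariant]
    simp [SymLie.coAd, SymLie.Ad, SymGroup.inv_def]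
  refine Prod.ext ?_ ?_
  · ext i
    change J (g • x) (0, EuclideanSpace.single i 1, 0) = _
    rw [key, dual_shift_eq]
    -- The transpose of `rot (-φ)` is `rot φ`.
    fin_cases i <;> simp [rot, PiLp.inner_apply, Fin.sum_univ_three] <;> ring
  · change J (g • x) (0, 0, 1) = J x (0, 0, 1)
    rw [key]; simp

theorem shiftMomenta_shift_smul (hJ : IsEquivariantMomentumMap Ω J) (b : E3) (ψ : Real.Angle)
    (x : M) : shiftMomenta J (SymGroup.shift b ψ • x) = shiftMomenta J x := by
  rw [hJ.shiftMomenta_smul]; simp [SymGroup.shift, SymGroup.rot_zero]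

theorem shiftMomenta_diag_smul (hJ : IsEquivariantMomentumMap Ω J) (φ : Real.Angle)
    {x : M} (hx : IsVertical (shiftMomenta J x)) :
    shiftMomenta J (SymGroup.diag φ • x) = shiftMomenta J x := by
  obtain ⟨c, hc⟩ := hx
  rw [hJ.shiftMomenta_smul]
  exact Prod.ext (by simp only [hc, rot_vertical]) rfl

end IsEquivariantMomentumMap

end Momenta

/-! ### Smooth orbit curves and their velocities -/

section Actions

variable {E : Type*} [NormedAddCommGroup E] [NormedSpace ℝ E]
  {M : Type*} [TopologicalSpace M] [ChartedSpace E M] [MulAction SymGroup M]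

theorem generator_eq {ξ : SymLie} {x : M} {γ : ℝ → M}
    (h : (fun t : ℝ => SymLie.exp (t • ξ) • x) = γ) :
    (generator ξ x : E) = (mfderiv 𝓘(ℝ, ℝ) 𝓘(ℝ, E) γ 0 (1 : ℝ) : E) := by
  subst h; rfl

namespace IsSmoothAction

theorem contMDiff_curve_smul (h : IsSmoothAction E M)
    {X : Type*} [NormedAddCommGroup X] [NormedSpace ℝ X] {s : Set X}
    {g : X → ℝ × E3 × ℝ} {F : X → M} (hg : ContDiff ℝ ∞ g)
    (hF : ContMDiffOn 𝓘(ℝ, X) 𝓘(ℝ, E) ∞ F s) :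
    ContMDiffOn 𝓘(ℝ, X) 𝓘(ℝ, E) ∞
      (fun y => (⟨(g y).1, (g y).2.1, (g y).2.2⟩ : SymGroup) • F y) s :=
  ContMDiff.comp_contMDiffOn (g := fun p : (ℝ × E3 × ℝ) × M =>
    (⟨p.1.1, p.1.2.1, p.1.2.2⟩ : SymGroup) • p.2) h (hg.contMDiff.contMDiffOn.prodMk hF)

theorem contMDiff_smul (h : IsSmoothAction E M) (g : SymGroup) :
    ContMDiff 𝓘(ℝ, E) 𝓘(ℝ, E) ∞ (fun x : M => g • x) := by
  have := ContMDiff.comp (g := fun p : (ℝ × E3 × ℝ) × M =>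
    (⟨p.1.1, p.1.2.1, p.1.2.2⟩ : SymGroup) • p.2) h
    ((contMDiff_const (c := ((g.rotation.toReal, g.translation, g.spin.toReal) :
      ℝ × E3 × ℝ))).prodMk (contMDiff_id (I := 𝓘(ℝ, E)) (M := M)))
  simpa [Function.comp_def] using this

theorem contMDiff_diag_curve (h : IsSmoothAction E M) (x : M) :
    ContMDiff 𝓘(ℝ, ℝ) 𝓘(ℝ, E) ∞ (fun t : ℝ => SymGroup.diag (t : Real.Angle) • x) :=
  contMDiffOn_univ.1 (h.contMDiff_curve_smul (s := univ) (g := fun t : ℝ => (t, 0, t))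
    (by fun_prop) contMDiff_const.contMDiffOn)

theorem contMDiff_shift_curve (h : IsSmoothAction E M) (b : E3) (ψ : ℝ) (x : M) :
    ContMDiff 𝓘(ℝ, ℝ) 𝓘(ℝ, E) ∞
      (fun t : ℝ => SymGroup.shift (t • b) ((t * ψ : ℝ) : Real.Angle) • x) := by
  have := contMDiffOn_univ.1 (h.contMDiff_curve_smul (s := univ)
    (g := fun t : ℝ => (0, t • b, t * ψ)) (by fun_prop)
    (contMDiff_const (c := x)).contMDiffOn)
  simpa [SymGroup.shift] using this

variable {Y : Type*} [NormedAddCommGroup Y] [NormedSpace ℝ Y]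

theorem hasDerivAt_diag (h : IsSmoothAction E M) {G : M → Y} {x : M}
    (hG : MDifferentiableAt 𝓘(ℝ, E) 𝓘(ℝ, Y) G x) :
    HasDerivAt (fun t : ℝ => G (SymGroup.diag (t : Real.Angle) • x))
      (mfderiv 𝓘(ℝ, E) 𝓘(ℝ, Y) G x (generator ((1, 0, 1) : SymLie) x) : Y) 0 := by
  have h0 : SymGroup.diag ((0 : ℝ) : Real.Angle) • x = x := by
    simp [SymGroup.diag_zero]
  have := HasDerivAt.of_mdifferentiableAt_comp (G := G) (E := E)
    (γ := fun t : ℝ => SymGroup.diag (t : Real.Angle) • x) (t := 0)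
    (by rw [h0]; exact hG) ((h.contMDiff_diag_curve x).mdifferentiable (by simp) 0)
  rw [generator_eq (funext fun t => by rw [SymLie.exp_diag])]
  rw [h0] at this
  exact this

theorem hasDerivAt_shift (h : IsSmoothAction E M) {G : M → Y} (b : E3) (ψ t : ℝ) {x : M}
    (hG : MDifferentiableAt 𝓘(ℝ, E) 𝓘(ℝ, Y) G
      (SymGroup.shift (t • b) ((t * ψ : ℝ) : Real.Angle) • x)) :
    HasDerivAt (fun t : ℝ => G (SymGroup.shift (t • b) ((t * ψ : ℝ) : Real.Angle) • x))
      (mfderiv 𝓘(ℝ, E) 𝓘(ℝ, Y) G (SymGroup.shift (t • b) ((t * ψ : ℝ) : Real.Angle) • x)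
        (generator ((0, b, ψ) : SymLie)
          (SymGroup.shift (t • b) ((t * ψ : ℝ) : Real.Angle) • x)) : Y) t := by
  set y := SymGroup.shift (t • b) ((t * ψ : ℝ) : Real.Angle) • x with hy
  have h0 : SymGroup.shift ((0 : ℝ) • b) ((0 * ψ : ℝ) : Real.Angle) • y = y := by
    simp [SymGroup.shift_zero]
  have key := HasDerivAt.of_mdifferentiableAt_comp (G := G) (E := E)
    (γ := fun t : ℝ => SymGroup.shift (t • b) ((t * ψ : ℝ) : Real.Angle) • y) (t := 0)
    (by rw [h0]; exact hG) ((h.contMDiff_shift_curve b ψ y).mdifferentiable (by simp) 0)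
  rw [h0] at key
  rw [generator_eq (funext fun t => by rw [SymLie.exp_shift])]
  -- By the one-parameter group law the curve at time `s` is the curve through `y` at time `s - t`,
  -- so the derivative at `t` is the one at `0` based at `y`.
  have key' := HasDerivAt.comp_sub_const t t (by rw [sub_self]; exact key)
  refine key'.congr_of_eventuallyEq (.of_forall fun s => ?_)
  simp only [hy, smul_smul, SymGroup.shift_mul_shift, ← add_smul, ← Real.Angle.coe_add, ← add_mul,
    sub_add_cancel]

end IsSmoothAction

end Actions

/-! ### Derivatives of composites known in closed form -/

section Chain

variable {E : Type*} [NormedAddCommGroup E] [NormedSpace ℝ E]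
  {M : Type*} [TopologicalSpace M] [ChartedSpace E M]
  {X : Type*} [NormedAddCommGroup X] [NormedSpace ℝ X]
  {Y : Type*} [NormedAddCommGroup Y] [NormedSpace ℝ Y]

theorem mfderiv_mfderiv_eq_of_eqOn {G : M → Y} {F : X → M} {f : X → Y} {f' : X →L[ℝ] Y}
    {s : Set X} {x : X} (hs : s ∈ 𝓝 x)
    (hG : MDifferentiableAt 𝓘(ℝ, E) 𝓘(ℝ, Y) G (F x))
    (hF : MDifferentiableAt 𝓘(ℝ, X) 𝓘(ℝ, E) F x) (hf : HasFDerivAt f f' x)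
    (h : ∀ y ∈ s, G (F y) = f y) (u : X) :
    (mfderiv 𝓘(ℝ, E) 𝓘(ℝ, Y) G (F x) (mfderiv 𝓘(ℝ, X) 𝓘(ℝ, E) F x u) : Y) = f' u := by
  obtain ⟨L, hL, hLu⟩ : ∃ L : X →L[ℝ] Y, HasFDerivAt (fun y => G (F y)) L x ∧
      L u = (mfderiv 𝓘(ℝ, E) 𝓘(ℝ, Y) G (F x) (mfderiv 𝓘(ℝ, X) 𝓘(ℝ, E) F x u) : Y) :=
    ⟨_, HasFDerivAt.of_mdifferentiableAt_comp hG hF, rfl⟩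
  have h2 : HasFDerivAt (fun y => G (F y)) f' x :=
    hf.congr_of_eventuallyEq (Filter.mem_of_superset hs h)
  rw [← hLu, hL.unique h2]

theorem mfderiv_mfderiv_eq_fderiv {G : M → Y} {F : X → M} {x : X}
    (hG : MDifferentiableAt 𝓘(ℝ, E) 𝓘(ℝ, Y) G (F x))
    (hF : MDifferentiableAt 𝓘(ℝ, X) 𝓘(ℝ, E) F x) (u : X) :
    (mfderiv 𝓘(ℝ, E) 𝓘(ℝ, Y) G (F x) (mfderiv 𝓘(ℝ, X) 𝓘(ℝ, E) F x u) : Y)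
      = fderiv ℝ (fun y => G (F y)) x u := by
  obtain ⟨L, hL, hLu⟩ : ∃ L : X →L[ℝ] Y, HasFDerivAt (fun y => G (F y)) L x ∧
      L u = (mfderiv 𝓘(ℝ, E) 𝓘(ℝ, Y) G (F x) (mfderiv 𝓘(ℝ, X) 𝓘(ℝ, E) F x u) : Y) :=
    ⟨_, HasFDerivAt.of_mdifferentiableAt_comp hG hF, rfl⟩
  rw [← hLu, hL.fderiv]

end Chain

/-! ### Derivatives of the coordinates, and the shifts in coordinates -/

namespace ReductionCoordinates

variable {E : Type*} [NormedAddCommGroup E] [NormedSpace ℝ E]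
  {M : Type*} [TopologicalSpace M] [ChartedSpace E M] [MulAction SymGroup M]
  {Ω : ∀ x : M, TangentSpace 𝓘(ℝ, E) x [⋀^Fin 2]→L[ℝ] ℝ}
  {J : M → Module.Dual ℝ SymLie} {xe : M} {k : ℕ} (C : ReductionCoordinates Ω J xe k)

/-- The inverse coordinate map, with the angle `θ` lifted to `ℝ`. -/
def lift (c : CoordSpace k) : M := C.point c.1 (c.2.1 : Real.Angle) c.2.2.1 c.2.2.2

theorem isOpen_domain : IsOpen {c : CoordSpace k | c.2.2 ∈ C.V} :=
  C.isOpen_V.preimage (by fun_prop)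

theorem isOpen_leaf (ν : Momenta) : IsOpen (C.leaf ν) :=
  C.isOpen_V.preimage (by fun_prop)

variable {C}

theorem lift_mem {c : CoordSpace k} (hc : c.2.2 ∈ C.V) : C.lift c ∈ C.U :=
  C.point_mem _ _ _ _ hc

theorem exists_lift_eq {x : M} (hx : x ∈ C.U) : ∃ c : CoordSpace k, c.2.2 ∈ C.V ∧ C.lift c = x := by
  refine ⟨(C.a x, (C.θ x).toReal, (Jtranslation J x, Jspin J x), C.w x), C.mem_V x hx, ?_⟩
  simp only [lift, Real.Angle.coe_toReal]
  exact C.point_coords x hx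

theorem mdifferentiableAt_lift {c : CoordSpace k} (hc : c.2.2 ∈ C.V) :
    MDifferentiableAt 𝓘(ℝ, CoordSpace k) 𝓘(ℝ, E) C.lift c :=
  (C.smooth_point.contMDiffAt (C.isOpen_domain.mem_nhds hc)).mdifferentiableAt (by simp)

theorem mdifferentiableAt_of_contMDiffOn_U {Y : Type*} [NormedAddCommGroup Y] [NormedSpace ℝ Y]
    {G : M → Y} (hG : ContMDiffOn 𝓘(ℝ, E) 𝓘(ℝ, Y) ∞ G C.U) {x : M} (hx : x ∈ C.U) :
    MDifferentiableAt 𝓘(ℝ, E) 𝓘(ℝ, Y) G x :=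
  (hG.contMDiffAt (C.isOpen_U.mem_nhds hx)).mdifferentiableAt (by simp)

theorem mfderiv_w_lift {c : CoordSpace k} (hc : c.2.2 ∈ C.V) (u : CoordSpace k) :
    (mfderiv 𝓘(ℝ, E) 𝓘(ℝ, WSpace k) C.w (C.lift c)
      (mfderiv 𝓘(ℝ, CoordSpace k) 𝓘(ℝ, E) C.lift c u) : WSpace k) = u.2.2.2 :=
  mfderiv_mfderiv_eq_of_eqOn (C.isOpen_domain.mem_nhds hc)
    (mdifferentiableAt_of_contMDiffOn_U C.smooth_w (lift_mem hc)) (mdifferentiableAt_lift hc)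
    ((ContinuousLinearMap.snd ℝ Momenta (WSpace k)).comp
      ((ContinuousLinearMap.snd ℝ ℝ _).comp (ContinuousLinearMap.snd ℝ E3 _))).hasFDerivAt
    (fun _ hc => C.w_point _ _ _ _ hc) u

theorem mfderiv_a_lift {c : CoordSpace k} (hc : c.2.2 ∈ C.V) (u : CoordSpace k) :
    (mfderiv 𝓘(ℝ, E) 𝓘(ℝ, E3) C.a (C.lift c)
      (mfderiv 𝓘(ℝ, CoordSpace k) 𝓘(ℝ, E) C.lift c u) : E3) = u.1 :=
  mfderiv_mfderiv_eq_of_eqOn (C.isOpen_domain.mem_nhds hc)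
    (mdifferentiableAt_of_contMDiffOn_U C.smooth_a (lift_mem hc)) (mdifferentiableAt_lift hc)
    (hasFDerivAt_fst (𝕜 := ℝ) (p := c)) (fun _ hc => C.a_point _ _ _ _ hc) u

/-- The coordinate `θ` is circle-valued, so its derivative is tracked through its cosine and sine.
-/
theorem mfderiv_cos_lift {c : CoordSpace k} (hc : c.2.2 ∈ C.V) (u : CoordSpace k) :
    (mfderiv 𝓘(ℝ, E) 𝓘(ℝ, ℝ) (fun x => (C.θ x).cos) (C.lift c)
      (mfderiv 𝓘(ℝ, CoordSpace k) 𝓘(ℝ, E) C.lift c u) : ℝ)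
      = -(C.θ (C.lift c)).sin * u.2.1 := by
  rw [show C.θ (C.lift c) = (c.2.1 : Real.Angle) from C.θ_point _ _ _ _ hc, Real.Angle.sin_coe]
  exact mfderiv_mfderiv_eq_of_eqOn (C.isOpen_domain.mem_nhds hc)
    (mdifferentiableAt_of_contMDiffOn_U C.smooth_cos_θ (lift_mem hc)) (mdifferentiableAt_lift hc)
    (hasFDerivAt_fst.comp c (hasFDerivAt_snd (𝕜 := ℝ) (p := c))).cos
    (fun _ hc => by
      rw [show C.θ (C.lift _) = _ from C.θ_point _ _ _ _ hc]; rfl) u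

theorem mfderiv_sin_lift {c : CoordSpace k} (hc : c.2.2 ∈ C.V) (u : CoordSpace k) :
    (mfderiv 𝓘(ℝ, E) 𝓘(ℝ, ℝ) (fun x => (C.θ x).sin) (C.lift c)
      (mfderiv 𝓘(ℝ, CoordSpace k) 𝓘(ℝ, E) C.lift c u) : ℝ)
      = (C.θ (C.lift c)).cos * u.2.1 := by
  rw [show C.θ (C.lift c) = (c.2.1 : Real.Angle) from C.θ_point _ _ _ _ hc, Real.Angle.cos_coe]
  exact mfderiv_mfderiv_eq_of_eqOn (C.isOpen_domain.mem_nhds hc)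
    (mdifferentiableAt_of_contMDiffOn_U C.smooth_sin_θ (lift_mem hc)) (mdifferentiableAt_lift hc)
    (hasFDerivAt_fst.comp c (hasFDerivAt_snd (𝕜 := ℝ) (p := c))).sin
    (fun _ hc => by
      rw [show C.θ (C.lift _) = _ from C.θ_point _ _ _ _ hc]; rfl) u

theorem mfderiv_shiftMomenta_lift (hJ : IsEquivariantMomentumMap Ω J) {c : CoordSpace k}
    (hc : c.2.2 ∈ C.V) (u : CoordSpace k) :
    (mfderiv 𝓘(ℝ, E) 𝓘(ℝ, Momenta) (shiftMomenta J) (C.lift c)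
      (mfderiv 𝓘(ℝ, CoordSpace k) 𝓘(ℝ, E) C.lift c u) : Momenta) = u.2.2.1 :=
  mfderiv_mfderiv_eq_of_eqOn (C.isOpen_domain.mem_nhds hc)
    (hJ.contMDiff_shiftMomenta.mdifferentiable (by simp) _) (mdifferentiableAt_lift hc)
    ((ContinuousLinearMap.fst ℝ Momenta (WSpace k)).comp
      ((ContinuousLinearMap.snd ℝ ℝ _).comp (ContinuousLinearMap.snd ℝ E3 _))).hasFDerivAt
    (fun _ hc => C.ν_point _ _ _ _ hc) u

theorem form_lift {c : CoordSpace k} (hc : c.2.2 ∈ C.V) (u v : CoordSpace k) :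
    Ω (C.lift c) ![mfderiv 𝓘(ℝ, CoordSpace k) 𝓘(ℝ, E) C.lift c u,
      mfderiv 𝓘(ℝ, CoordSpace k) 𝓘(ℝ, E) C.lift c v] = canonicalForm u v :=
  C.canonical c hc u v

/-- The pulled-back form is nondegenerate, so the derivative is injective; both dimensions are `3 +
1 + 4 + 2k`. It allows any tangent vector to be written in coordinates. -/
theorem mfderiv_lift_surjective [FiniteDimensional ℝ E] (hk : Module.finrank ℝ E = 2 * k + 8)
    {c : CoordSpace k} (hc : c.2.2 ∈ C.V) (X : E) :
    ∃ u : CoordSpace k, (mfderiv 𝓘(ℝ, CoordSpace k) 𝓘(ℝ, E) C.lift c u : E) = X := by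
  obtain ⟨D, hD⟩ : ∃ D : CoordSpace k →L[ℝ] E,
      D = mfderiv 𝓘(ℝ, CoordSpace k) 𝓘(ℝ, E) C.lift c := ⟨_, rfl⟩
  have hinj : Function.Injective D := by
    refine (injective_iff_map_eq_zero D).2 fun u hu => canonicalForm_nondegenerate fun v => ?_
    rw [← C.form_lift hc]
    refine (Ω (C.lift c)).map_coord_zero 0 ?_
    rw [hD] at hu
    exact hu
  have hsurj : Function.Surjective D :=
    (LinearMap.injective_iff_surjective_of_finrank_eq_finrank (f := (D : CoordSpace k →ₗ[ℝ] E))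
      (by simp [hk, Module.finrank_prod]; ring)).1 hinj
  obtain ⟨u, hu⟩ := hsurj X
  exact ⟨u, by rw [← hu, hD]; rfl⟩

/-- On vectors tangent to the levels of the momenta `ν`, the symplectic form is `dq ∧ dp`. -/
theorem form_eq_formW [FiniteDimensional ℝ E] (hk : Module.finrank ℝ E = 2 * k + 8)
    (hJ : IsEquivariantMomentumMap Ω J) {x : M} (hx : x ∈ C.U) {X Y : TangentSpace 𝓘(ℝ, E) x}
    (hX : (mfderiv 𝓘(ℝ, E) 𝓘(ℝ, Momenta) (shiftMomenta J) x X : Momenta) = 0)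
    (hY : (mfderiv 𝓘(ℝ, E) 𝓘(ℝ, Momenta) (shiftMomenta J) x Y : Momenta) = 0) :
    Ω x ![X, Y] = formW (mfderiv 𝓘(ℝ, E) 𝓘(ℝ, WSpace k) C.w x X : WSpace k)
      (mfderiv 𝓘(ℝ, E) 𝓘(ℝ, WSpace k) C.w x Y : WSpace k) := by
  obtain ⟨c, hc, rfl⟩ := exists_lift_eq hx
  obtain ⟨u, rfl⟩ := mfderiv_lift_surjective hk hc X
  obtain ⟨v, rfl⟩ := mfderiv_lift_surjective hk hc Y
  have hu : u.2.2.1 = (0 : Momenta) := (mfderiv_shiftMomenta_lift hJ hc u).symm.trans hX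
  have hv : v.2.2.1 = (0 : Momenta) := (mfderiv_shiftMomenta_lift hJ hc v).symm.trans hY
  refine (C.form_lift hc u v).trans ?_
  refine Eq.trans ?_ (congrArg₂ formW (mfderiv_w_lift hc u) (mfderiv_w_lift hc v)).symm
  rw [canonicalForm, hu, hv]
  simp

/-- In the coordinates, the generators of `ℝ³ × SO(2)` are `b ∂_a + ψ ∂_θ`. -/
theorem generator_shift_lift [FiniteDimensional ℝ E] (hk : Module.finrank ℝ E = 2 * k + 8)
    (hJ : IsEquivariantMomentumMap Ω J) {c : CoordSpace k}
    (hc : c.2.2 ∈ C.V) (b : E3) (ψ : ℝ) :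
    generator ((0, b, ψ) : SymLie) (C.lift c)
      = (mfderiv 𝓘(ℝ, CoordSpace k) 𝓘(ℝ, E) C.lift c ((b, ψ, 0, 0) : CoordSpace k) : E) := by
  obtain ⟨u, hu⟩ := mfderiv_lift_surjective hk hc (generator ((0, b, ψ) : SymLie) (C.lift c))
  refine hu.symm.trans ?_
  suffices h : u = (b, ψ, 0, 0) by rw [h]
  refine sub_eq_zero.1 (canonicalForm_nondegenerate fun v => ?_)
  -- Here `u` is the generator in coordinates. The momentum identity evaluates its pairing with `v`
  -- as the differential of `⟨b, ν^a⟩ + ψ ν^θ`, which is also the pairing of `(b, ψ, 0, 0)` with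
  -- `v`.
  have h1 : canonicalForm u v = inner ℝ b v.2.2.1.1 + ψ * v.2.2.1.2 := by
    rw [← C.form_lift hc u v]
    have h2 := hJ.momentum (0, b, ψ) (C.lift c) (mfderiv 𝓘(ℝ, CoordSpace k) 𝓘(ℝ, E) C.lift c v)
    have h3 : (mfderiv 𝓘(ℝ, E) 𝓘(ℝ, ℝ) (fun y => J y (0, b, ψ)) (C.lift c)
        (mfderiv 𝓘(ℝ, CoordSpace k) 𝓘(ℝ, E) C.lift c v) : ℝ)
        = inner ℝ b v.2.2.1.1 + ψ * v.2.2.1.2 := by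
      let L : CoordSpace k →L[ℝ] ℝ :=
        ((innerSL ℝ b).comp (ContinuousLinearMap.fst ℝ E3 ℝ) +
          ψ • ContinuousLinearMap.snd ℝ E3 ℝ).comp
          ((ContinuousLinearMap.fst ℝ Momenta (WSpace k)).comp
          ((ContinuousLinearMap.snd ℝ ℝ _).comp (ContinuousLinearMap.snd ℝ E3 _)))
      refine mfderiv_mfderiv_eq_of_eqOn (C.isOpen_domain.mem_nhds hc)
        (((hJ.smooth _).mdifferentiable (by simp)) _) (mdifferentiableAt_lift hc)
        (f := L) L.hasFDerivAt ?_ v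
      intro d hd
      change _ = inner ℝ b d.2.2.1.1 + ψ * d.2.2.1.2
      rw [dual_shift_eq, shiftMomenta, lift, C.ν_point _ _ _ _ hd]
    refine Eq.trans ?_ (h2.trans h3)
    congr 2
  have h4 : canonicalForm (u - (b, ψ, 0, 0)) v
      = canonicalForm u v - (inner ℝ b v.2.2.1.1 + ψ * v.2.2.1.2) := by
    simp [canonicalForm, formW, inner_sub_left]; ring
  rw [h4, h1, sub_self]

theorem _root_.Real.Angle.eq_of_cos_sin {α β : Real.Angle} (hc : α.cos = β.cos)
    (hs : α.sin = β.sin) : α = β := by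
  induction α using Real.Angle.induction_on
  induction β using Real.Angle.induction_on
  exact Real.Angle.cos_sin_inj (by simpa using hc) (by simpa using hs)

/-- In the coordinates, `ℝ³ × SO(2)` acts by translations of `a` and `θ`. -/
theorem coords_shift_smul [FiniteDimensional ℝ E] (hk : Module.finrank ℝ E = 2 * k + 8)
    (hsmooth : IsSmoothAction E M) (hJ : IsEquivariantMomentumMap Ω J)
    {x : M} (hx : x ∈ C.U) (b : E3) (ψ : Real.Angle) :
    C.a (SymGroup.shift b ψ • x) = b + C.a x ∧ C.θ (SymGroup.shift b ψ • x) = ψ + C.θ x ∧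
      C.w (SymGroup.shift b ψ • x) = C.w x := by
  induction ψ using Real.Angle.induction_on with | _ ψ
  -- The one-parameter orbit from `x` at time `0` to the shifted point at time `1`.
  set g : ℝ → M := fun t => SymGroup.shift (t • b) ((t * ψ : ℝ) : Real.Angle) • x with hg
  have hgU : ∀ t, g t ∈ C.U := fun t => C.smul_mem _ _ hx
  have hg0 : g 0 = x := by simp [hg, SymGroup.shift_zero]
  have hg1 : g 1 = SymGroup.shift b (ψ : Real.Angle) • x := by simp [hg]
  have ha : ∀ t, HasDerivAt (fun t => C.a (g t)) b t := fun t => by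
    have h := hsmooth.hasDerivAt_shift b ψ t
      (mdifferentiableAt_of_contMDiffOn_U C.smooth_a (hgU t))
    obtain ⟨c, hc, hcx⟩ := exists_lift_eq (hgU t)
    simp only [hg] at hcx
    rw [← hcx, generator_shift_lift hk hJ hc] at h
    exact h.congr_deriv (mfderiv_a_lift hc (b, ψ, 0, 0))
  have hw : ∀ t, HasDerivAt (fun t => C.w (g t)) 0 t := fun t => by
    have h := hsmooth.hasDerivAt_shift b ψ t
      (mdifferentiableAt_of_contMDiffOn_U C.smooth_w (hgU t))
    obtain ⟨c, hc, hcx⟩ := exists_lift_eq (hgU t)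
    simp only [hg] at hcx
    rw [← hcx, generator_shift_lift hk hJ hc] at h
    exact h.congr_deriv (mfderiv_w_lift hc (b, ψ, 0, 0))
  have hcos : ∀ t, HasDerivAt (fun t => (C.θ (g t)).cos) (-(C.θ (g t)).sin * ψ) t := fun t => by
    have h := hsmooth.hasDerivAt_shift b ψ t
      (mdifferentiableAt_of_contMDiffOn_U C.smooth_cos_θ (hgU t))
    obtain ⟨c, hc, hcx⟩ := exists_lift_eq (hgU t)
    have hcx' := hcx
    simp only [hg] at hcx
    rw [← hcx, generator_shift_lift hk hJ hc] at h
    rw [← hcx']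
    exact h.congr_deriv (mfderiv_cos_lift hc (b, ψ, 0, 0))
  have hsin : ∀ t, HasDerivAt (fun t => (C.θ (g t)).sin) ((C.θ (g t)).cos * ψ) t := fun t => by
    have h := hsmooth.hasDerivAt_shift b ψ t
      (mdifferentiableAt_of_contMDiffOn_U C.smooth_sin_θ (hgU t))
    obtain ⟨c, hc, hcx⟩ := exists_lift_eq (hgU t)
    have hcx' := hcx
    simp only [hg] at hcx
    rw [← hcx, generator_shift_lift hk hJ hc] at h
    rw [← hcx']
    exact h.congr_deriv (mfderiv_sin_lift hc (b, ψ, 0, 0))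
  have hlin : ∀ t, HasDerivAt (fun t : ℝ => t * ψ) ψ t := fun t => by
    simpa using (hasDerivAt_id t).mul_const ψ
  have hconst : ∀ {Y : Type} [NormedAddCommGroup Y] [NormedSpace ℝ Y] {f : ℝ → Y},
      (∀ t, HasDerivAt f 0 t) → f 1 = f 0 := fun h =>
    is_const_of_deriv_eq_zero (fun t => (h t).differentiableAt) (fun t => (h t).deriv) 1 0
  rw [← hg1, ← hg0]
  refine ⟨?_, ?_, hconst hw⟩
  · have := hconst (f := fun t => C.a (g t) - t • b) fun t => by
      exact ((ha t).sub ((hasDerivAt_id t).smul_const b)).congr_deriv (by simp)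
    simp only [one_smul, zero_smul, sub_zero] at this
    rw [← this]; abel
  -- The constant functions in `h1` and `h2` are the cosine and sine of `θ (g t) - t ψ`; together
  -- they determine the angle.
  · have h1 := hconst (f := fun t => (C.θ (g t)).cos * Real.cos (t * ψ)
        + (C.θ (g t)).sin * Real.sin (t * ψ)) fun t => by
      refine (((hcos t).mul (hlin t).cos).add ((hsin t).mul (hlin t).sin)).congr_deriv ?_
      ring
    have h2 := hconst (f := fun t => (C.θ (g t)).sin * Real.cos (t * ψ)
        - (C.θ (g t)).cos * Real.sin (t * ψ)) fun t => by
      refine (((hsin t).mul (hlin t).cos).sub ((hcos t).mul (hlin t).sin)).congr_deriv ?_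
      ring
    simp only [one_mul, zero_mul, Real.cos_zero, Real.sin_zero, mul_one, mul_zero, add_zero,
      sub_zero] at h1 h2
    rw [add_comm, ← sub_eq_iff_eq_add]
    refine Real.Angle.eq_of_cos_sin ?_ ?_
    · rw [← h1, sub_eq_add_neg, Real.Angle.cos_add]; simp
    · rw [← h2, sub_eq_add_neg, Real.Angle.sin_add]; simp; ring

theorem eq_point_of_mem {x : M} (hx : x ∈ C.U) :
    C.point (C.a x) (C.θ x) (shiftMomenta J x) (C.w x) = x :=
  C.point_coords x hx

theorem shiftMomenta_point {ν : Momenta} {z : WSpace k} (hz : z ∈ C.leaf ν) (b : E3)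
    (ψ : Real.Angle) : shiftMomenta J (C.point b ψ ν z) = ν :=
  C.ν_point _ _ _ _ hz

theorem mem_leaf_w {x : M} (hx : x ∈ C.U) : C.w x ∈ C.leaf (shiftMomenta J x) :=
  C.mem_V x hx

/-! ### The induced action on the leaf -/

section Algebra

variable {ν : Momenta}

/-- Every point of the level is thus a shift of a point on the slice `a = 0`, `θ = 0`, where the
reduced objects are defined. -/
theorem shift_smul_point
    [FiniteDimensional ℝ E] (hk : Module.finrank ℝ E = 2 * k + 8) (hsmooth : IsSmoothAction E M)
    (hJ : IsEquivariantMomentumMap Ω J) {z : WSpace k} (hz : z ∈ C.leaf ν) (b : E3)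
    (ψ : Real.Angle) : SymGroup.shift b ψ • C.point 0 0 ν z = C.point b ψ ν z := by
  have hx : C.point 0 0 ν z ∈ C.U := C.point_mem _ _ _ _ hz
  obtain ⟨ha, hθ, hw⟩ := coords_shift_smul hk hsmooth hJ hx b ψ
  rw [← eq_point_of_mem (C.smul_mem (SymGroup.shift b ψ) _ hx), ha, hθ, hw,
    hJ.shiftMomenta_shift_smul, shiftMomenta_point hz, C.a_point _ _ _ _ hz,
    C.θ_point _ _ _ _ hz, C.w_point _ _ _ _ hz, add_zero, add_zero]

theorem shiftMomenta_diag_smul_point (hJ : IsEquivariantMomentumMap Ω J) (hν : IsVertical ν)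
    {z : WSpace k} (hz : z ∈ C.leaf ν) (φ : Real.Angle) (b : E3) (ψ : Real.Angle) :
    shiftMomenta J (SymGroup.diag φ • C.point b ψ ν z) = ν := by
  rw [hJ.shiftMomenta_diag_smul φ (by rwa [shiftMomenta_point hz]), shiftMomenta_point hz]

/-- The `w`-component of the action of `SO(2)_D` does not depend on `a` and `θ`. -/
theorem w_diag_smul_point
    [FiniteDimensional ℝ E] (hk : Module.finrank ℝ E = 2 * k + 8) (hsmooth : IsSmoothAction E M)
    (hJ : IsEquivariantMomentumMap Ω J) {z : WSpace k} (hz : z ∈ C.leaf ν) (φ : Real.Angle)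
    (b : E3) (ψ : Real.Angle) : C.w (SymGroup.diag φ • C.point b ψ ν z) = C.R ν φ z := by
  -- Moving the diagonal element past the shift leaves a shift on the outside, which does not affect
  -- `w`.
  rw [← shift_smul_point hk hsmooth hJ hz, smul_smul, SymGroup.diag_mul_shift, mul_smul]
  exact (coords_shift_smul hk hsmooth hJ (C.smul_mem _ _ (C.point_mem _ _ _ _ hz)) _ _).2.2

theorem R_mem_leaf (hJ : IsEquivariantMomentumMap Ω J) (hν : IsVertical ν) {z : WSpace k}
    (hz : z ∈ C.leaf ν) (φ : Real.Angle) : C.R ν φ z ∈ C.leaf ν := by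
  have h := mem_leaf_w (C.smul_mem (SymGroup.diag φ) _ (C.point_mem 0 0 _ _ hz))
  rwa [shiftMomenta_diag_smul_point hJ hν hz] at h

theorem exists_diag_smul_point (hJ : IsEquivariantMomentumMap Ω J) (hν : IsVertical ν)
    {z : WSpace k} (hz : z ∈ C.leaf ν) (φ : Real.Angle) :
    ∃ b ψ, SymGroup.diag φ • C.point 0 0 ν z = C.point b ψ ν (C.R ν φ z) := by
  have h := eq_point_of_mem (C.smul_mem (SymGroup.diag φ) _ (C.point_mem 0 0 _ _ hz))
  rw [shiftMomenta_diag_smul_point hJ hν hz] at h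
  exact ⟨_, _, h.symm⟩

/-- After acting by `χ` the point may have left the slice, whereas `R` restarts on it; independence
of `w` from `a` and `θ` makes the discrepancy harmless. -/
theorem R_add
    [FiniteDimensional ℝ E] (hk : Module.finrank ℝ E = 2 * k + 8) (hsmooth : IsSmoothAction E M)
    (hJ : IsEquivariantMomentumMap Ω J) (hν : IsVertical ν) {z : WSpace k} (hz : z ∈ C.leaf ν)
    (φ χ : Real.Angle) : C.R ν (φ + χ) z = C.R ν φ (C.R ν χ z) := by
  obtain ⟨b, ψ, h⟩ := exists_diag_smul_point hJ hν hz χ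
  rw [← w_diag_smul_point hk hsmooth hJ (R_mem_leaf hJ hν hz χ) φ b ψ, ← h, smul_smul,
    ← SymGroup.diag_add, R]

theorem R_zero {z : WSpace k} (hz : z ∈ C.leaf ν) : C.R ν 0 z = z := by
  rw [R, SymGroup.diag_zero, one_smul, C.w_point _ _ _ _ hz]

/-- The reduced Hamiltonian is invariant. -/
theorem redH_R
    [FiniteDimensional ℝ E] (hk : Module.finrank ℝ E = 2 * k + 8) (hsmooth : IsSmoothAction E M)
    (hJ : IsEquivariantMomentumMap Ω J) (hν : IsVertical ν) {H : M → ℝ}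
    (hH : ∀ (g : SymGroup) (x : M), H (g • x) = H x) {z : WSpace k} (hz : z ∈ C.leaf ν)
    (φ : Real.Angle) : C.redH H ν (C.R ν φ z) = C.redH H ν z := by
  obtain ⟨b, ψ, h⟩ := exists_diag_smul_point hJ hν hz φ
  rw [redH, redH, ← hH (SymGroup.shift b ψ), shift_smul_point hk hsmooth hJ (R_mem_leaf hJ hν hz φ),
    ← h, hH]

end Algebra

/-! ### Smoothness of the reduced objects -/

section Smoothness

variable {ν : Momenta}

theorem contMDiffOn_point : ContMDiffOn 𝓘(ℝ, WSpace k) 𝓘(ℝ, E) ∞ (C.point 0 0 ν) (C.leaf ν) := by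
  have h : ContDiff ℝ ∞ fun z : WSpace k => ((0, 0, ν, z) : CoordSpace k) := by fun_prop
  have := C.smooth_point.comp h.contMDiff.contMDiffOn (s := C.leaf ν) (fun z hz => hz)
  simpa [Function.comp_def] using this

theorem contDiffOn_R_uncurried (hsmooth : IsSmoothAction E M) :
    ContDiffOn ℝ ∞ (fun p : ℝ × WSpace k => C.R ν (p.1 : Real.Angle) p.2)
      ((univ : Set ℝ) ×ˢ C.leaf ν) := by
  rw [← contMDiffOn_iff_contDiffOn]
  have h1 : ContMDiffOn 𝓘(ℝ, ℝ × WSpace k) 𝓘(ℝ, E) ∞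
      (fun p : ℝ × WSpace k => C.point 0 0 ν p.2) (univ ×ˢ C.leaf ν) :=
    contMDiffOn_point.comp contDiff_snd.contMDiff.contMDiffOn (fun p hp => hp.2)
  exact C.smooth_w.comp (hsmooth.contMDiff_curve_smul (g := fun p : ℝ × WSpace k => (p.1, 0, p.1))
    (by fun_prop) h1) (fun p hp => C.smul_mem _ _ (C.point_mem _ _ _ _ hp.2))

variable {z : WSpace k}

theorem mdifferentiableAt_point (hz : z ∈ C.leaf ν) :
    MDifferentiableAt 𝓘(ℝ, WSpace k) 𝓘(ℝ, E) (C.point 0 0 ν) z :=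
  (contMDiffOn_point.contMDiffAt ((C.isOpen_leaf ν).mem_nhds hz)).mdifferentiableAt (by simp)

theorem mdifferentiable_smul (hsmooth : IsSmoothAction E M) (g : SymGroup) :
    MDifferentiable 𝓘(ℝ, E) 𝓘(ℝ, E) (fun x : M => g • x) :=
  (hsmooth.contMDiff_smul g).mdifferentiable (by simp)

theorem mdifferentiableAt_diag_smul_point (hsmooth : IsSmoothAction E M) (hz : z ∈ C.leaf ν)
    (φ : Real.Angle) :
    MDifferentiableAt 𝓘(ℝ, WSpace k) 𝓘(ℝ, E) (fun z => SymGroup.diag φ • C.point 0 0 ν z) z :=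
  (mdifferentiable_smul hsmooth _ _).comp z (mdifferentiableAt_point hz)

theorem differentiableAt_R (hsmooth : IsSmoothAction E M) (hz : z ∈ C.leaf ν) (φ : Real.Angle) :
    DifferentiableAt ℝ (C.R ν φ) z :=
  (HasFDerivAt.of_mdifferentiableAt_comp (F := fun z => SymGroup.diag φ • C.point 0 0 ν z)
    (mdifferentiableAt_of_contMDiffOn_U C.smooth_w
    (C.smul_mem _ _ (C.point_mem _ _ _ _ hz)))
    (mdifferentiableAt_diag_smul_point hsmooth hz φ)).differentiableAt

theorem contDiffOn_comp_point {G : M → ℝ} (hG : ContMDiff 𝓘(ℝ, E) 𝓘(ℝ, ℝ) ∞ G) :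
    ContDiffOn ℝ ∞ (fun z => G (C.point 0 0 ν z)) (C.leaf ν) :=
  contMDiffOn_iff_contDiffOn.1 (hG.comp_contMDiffOn contMDiffOn_point)

theorem differentiableAt_comp_point {G : M → ℝ} (hG : ContMDiff 𝓘(ℝ, E) 𝓘(ℝ, ℝ) ∞ G)
    (hz : z ∈ C.leaf ν) : DifferentiableAt ℝ (fun z => G (C.point 0 0 ν z)) z :=
  ((contDiffOn_comp_point hG).contDiffAt ((C.isOpen_leaf ν).mem_nhds hz)).differentiableAt (by simp)

end Smoothness

/-! ### Symplecticity and the momentum map on the leaf -/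

section Symplectic

variable {ν : Momenta} {z : WSpace k}

theorem mfderiv_shiftMomenta_point (hJ : IsEquivariantMomentumMap Ω J) (hz : z ∈ C.leaf ν)
    (u : WSpace k) :
    (mfderiv 𝓘(ℝ, E) 𝓘(ℝ, Momenta) (shiftMomenta J) (C.point 0 0 ν z)
      (mfderiv 𝓘(ℝ, WSpace k) 𝓘(ℝ, E) (C.point 0 0 ν) z u) : Momenta) = 0 :=
  mfderiv_mfderiv_eq_of_eqOn ((C.isOpen_leaf ν).mem_nhds hz)
    (hJ.contMDiff_shiftMomenta.mdifferentiable (by simp) _) (mdifferentiableAt_point hz)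
    (hasFDerivAt_const ν z) (fun _ hy => shiftMomenta_point hy _ _) u

theorem mfderiv_w_point (hz : z ∈ C.leaf ν) (u : WSpace k) :
    (mfderiv 𝓘(ℝ, E) 𝓘(ℝ, WSpace k) C.w (C.point 0 0 ν z)
      (mfderiv 𝓘(ℝ, WSpace k) 𝓘(ℝ, E) (C.point 0 0 ν) z u) : WSpace k) = u :=
  mfderiv_mfderiv_eq_of_eqOn ((C.isOpen_leaf ν).mem_nhds hz)
    (mdifferentiableAt_of_contMDiffOn_U C.smooth_w (C.point_mem _ _ _ _ hz))
    (mdifferentiableAt_point hz) (hasFDerivAt_id z) (fun _ hy => C.w_point _ _ _ _ hy) u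

/-- The slice and its image under the group element both lie in the level of `ν`, so `Ω` reads as
`dq ∧ dp` on each, and invariance of `Ω` compares the two. -/
theorem formW_fderiv_R
    [FiniteDimensional ℝ E] (hk : Module.finrank ℝ E = 2 * k + 8) (hsmooth : IsSmoothAction E M)
    (hsymp : PreservesForm Ω) (hJ : IsEquivariantMomentumMap Ω J) (hν : IsVertical ν)
    (hz : z ∈ C.leaf ν) (φ : Real.Angle) (u v : WSpace k) :
    formW (fderiv ℝ (C.R ν φ) z u) (fderiv ℝ (C.R ν φ) z v) = formW u v := by
  have hU := C.point_mem 0 0 _ _ hz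
  have hgU := C.smul_mem (SymGroup.diag φ) _ hU
  have hF := mdifferentiableAt_diag_smul_point hsmooth hz φ
  have hw : ∀ u, fderiv ℝ (C.R ν φ) z u = (mfderiv 𝓘(ℝ, E) 𝓘(ℝ, WSpace k) C.w
      (SymGroup.diag φ • C.point 0 0 ν z) (mfderiv 𝓘(ℝ, WSpace k) 𝓘(ℝ, E)
        (fun z => SymGroup.diag φ • C.point 0 0 ν z) z u) : WSpace k) := fun u =>
    (mfderiv_mfderiv_eq_fderiv (F := fun z => SymGroup.diag φ • C.point 0 0 ν z)
      (mdifferentiableAt_of_contMDiffOn_U C.smooth_w hgU) hF u).symm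
  have hν0 : ∀ u, (mfderiv 𝓘(ℝ, E) 𝓘(ℝ, Momenta) (shiftMomenta J)
      (SymGroup.diag φ • C.point 0 0 ν z) (mfderiv 𝓘(ℝ, WSpace k) 𝓘(ℝ, E)
        (fun z => SymGroup.diag φ • C.point 0 0 ν z) z u) : Momenta) = 0 := fun u =>
    mfderiv_mfderiv_eq_of_eqOn ((C.isOpen_leaf ν).mem_nhds hz)
      (hJ.contMDiff_shiftMomenta.mdifferentiable (by simp) _) hF (hasFDerivAt_const ν z)
      (fun _ hy => shiftMomenta_diag_smul_point hJ hν hy _ _ _) u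
  have hd : ∀ u, (mfderiv 𝓘(ℝ, WSpace k) 𝓘(ℝ, E)
      (fun z => SymGroup.diag φ • C.point 0 0 ν z) z u : E) = mfderiv 𝓘(ℝ, E) 𝓘(ℝ, E)
        (fun y : M => SymGroup.diag φ • y) (C.point 0 0 ν z)
        (mfderiv 𝓘(ℝ, WSpace k) 𝓘(ℝ, E) (C.point 0 0 ν) z u) := fun u =>
    DFunLike.congr_fun (mfderiv_comp z (mdifferentiable_smul hsmooth (SymGroup.diag φ) _)
      (mdifferentiableAt_point hz)) u
  rw [hw, hw, ← form_eq_formW hk hJ hgU (hν0 u) (hν0 v)]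
  have h1 := form_eq_formW hk hJ hU (mfderiv_shiftMomenta_point hJ hz u)
    (mfderiv_shiftMomenta_point hJ hz v)
  have h2 := hsymp (SymGroup.diag φ) (C.point 0 0 ν z)
    (mfderiv 𝓘(ℝ, WSpace k) 𝓘(ℝ, E) (C.point 0 0 ν) z u)
    (mfderiv 𝓘(ℝ, WSpace k) 𝓘(ℝ, E) (C.point 0 0 ν) z v)
  refine Eq.trans ?_ (h2.trans (h1.trans (congrArg₂ formW (mfderiv_w_point hz u)
    (mfderiv_w_point hz v))))
  exact congrArg₂ (fun X Y : E => Ω (SymGroup.diag φ • C.point 0 0 ν z) ![X, Y]) (hd u) (hd v)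

theorem formW_deriv_R
    [FiniteDimensional ℝ E] (hk : Module.finrank ℝ E = 2 * k + 8) (hsmooth : IsSmoothAction E M)
    (hJ : IsEquivariantMomentumMap Ω J) (hν : IsVertical ν) (hz : z ∈ C.leaf ν) (v : WSpace k) :
    formW (deriv (fun t : ℝ => C.R ν (t : Real.Angle) z) 0) v = fderiv ℝ (C.JW ν) z v := by
  have hU := C.point_mem 0 0 _ _ hz
  have hνd := hJ.contMDiff_shiftMomenta.mdifferentiable (by simp) (C.point 0 0 ν z)
  have h1 : deriv (fun t : ℝ => C.R ν (t : Real.Angle) z) 0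
      = (mfderiv 𝓘(ℝ, E) 𝓘(ℝ, WSpace k) C.w (C.point 0 0 ν z)
        (generator ((1, 0, 1) : SymLie) (C.point 0 0 ν z)) : WSpace k) :=
    (hsmooth.hasDerivAt_diag (mdifferentiableAt_of_contMDiffOn_U C.smooth_w hU)).deriv
  -- The diagonal orbit stays in the level of the vertical `ν`, so its velocity is tangent to that
  -- level.
  have h2 : (mfderiv 𝓘(ℝ, E) 𝓘(ℝ, Momenta) (shiftMomenta J) (C.point 0 0 ν z)
      (generator ((1, 0, 1) : SymLie) (C.point 0 0 ν z)) : Momenta) = 0 := by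
    refine (hsmooth.hasDerivAt_diag hνd).unique ?_
    simp only [shiftMomenta_diag_smul_point hJ hν hz]
    exact hasDerivAt_const _ _
  rw [h1]
  refine ((congrArg (formW _) (mfderiv_w_point hz v)).symm.trans
    (form_eq_formW hk hJ hU h2 (mfderiv_shiftMomenta_point hJ hz v)).symm).trans ?_
  refine (hJ.momentum (1, 0, 1) _ _).trans ?_
  rw [show C.JW ν = fun y => J (C.point 0 0 ν y) (1, 0, 1) from funext fun y => Jdiag_eq J _]
  exact mfderiv_mfderiv_eq_fderiv ((hJ.smooth _).mdifferentiable (by simp) _)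
    (mdifferentiableAt_point hz) v

end Symplectic

/-! ### Symmetry and conservation law of the reduced system -/

section Dynamics

variable {ν : Momenta} {z : WSpace k} {H : M → ℝ}

/-- A linear map preserving a nondegenerate form is injective, hence onto in finite dimension. This
allows test vectors in the image point to be pulled back. -/
theorem fderiv_R_surjective
    [FiniteDimensional ℝ E] (hk : Module.finrank ℝ E = 2 * k + 8) (hsmooth : IsSmoothAction E M)
    (hsymp : PreservesForm Ω) (hJ : IsEquivariantMomentumMap Ω J) (hν : IsVertical ν)
    (hz : z ∈ C.leaf ν) (φ : Real.Angle) : Function.Surjective (fderiv ℝ (C.R ν φ) z) := by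
  refine (LinearMap.injective_iff_surjective
    (f := (fderiv ℝ (C.R ν φ) z : WSpace k →ₗ[ℝ] WSpace k))).1 ?_
  intro u u' h
  refine formW_nondegenerate fun v => ?_
  rw [← formW_fderiv_R hk hsmooth hsymp hJ hν hz φ u v,
    ← formW_fderiv_R hk hsmooth hsymp hJ hν hz φ u' v]
  exact congrArg (fun x => formW x _) h

/-- The reduced vector field is equivariant. -/
theorem fderiv_R_redField
    [FiniteDimensional ℝ E] (hk : Module.finrank ℝ E = 2 * k + 8) (hsmooth : IsSmoothAction E M)
    (hsymp : PreservesForm Ω) (hJ : IsEquivariantMomentumMap Ω J) (hν : IsVertical ν)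
    (hH : ContMDiff 𝓘(ℝ, E) 𝓘(ℝ, ℝ) ∞ H) (hHinv : ∀ (g : SymGroup) (x : M), H (g • x) = H x)
    (hz : z ∈ C.leaf ν) (φ : Real.Angle) :
    fderiv ℝ (C.R ν φ) z (C.redField H ν z) = C.redField H ν (C.R ν φ z) := by
  refine formW_nondegenerate fun v => ?_
  -- Paired with the image of `v`, the left side gives `dH(v)` by symplecticity and the right side
  -- gives `d(H ∘ R_φ)(v)`; these agree by invariance.
  obtain ⟨v, rfl⟩ := fderiv_R_surjective hk hsmooth hsymp hJ hν hz φ v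
  rw [formW_fderiv_R hk hsmooth hsymp hJ hν hz, redField, redField, formW_structJ, formW_structJ]
  have h1 : HasFDerivAt (fun y => C.redH H ν (C.R ν φ y)) _ z :=
    (differentiableAt_comp_point hH (R_mem_leaf hJ hν hz φ)).hasFDerivAt.comp z
      (differentiableAt_R hsmooth hz φ).hasFDerivAt
  have h2 : C.redH H ν =ᶠ[𝓝 z] fun y => C.redH H ν (C.R ν φ y) :=
    Filter.mem_of_superset ((C.isOpen_leaf ν).mem_nhds hz)
      fun y hy => (redH_R hk hsmooth hJ hν hHinv hy φ).symm
  rw [(h1.congr_of_eventuallyEq h2).fderiv]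
  rfl

theorem IsReducedSolution.map_R [FiniteDimensional ℝ E] (hk : Module.finrank ℝ E = 2 * k + 8)
    (hsmooth : IsSmoothAction E M) (hsymp : PreservesForm Ω)
    (hJ : IsEquivariantMomentumMap Ω J) (hν : IsVertical ν)
    (hH : ContMDiff 𝓘(ℝ, E) 𝓘(ℝ, ℝ) ∞ H) (hHinv : ∀ (g : SymGroup) (x : M), H (g • x) = H x)
    {I : Set ℝ} {γ : ℝ → WSpace k} (hγ : C.IsReducedSolution H ν I γ) (φ : Real.Angle) :
    C.IsReducedSolution H ν I (fun t => C.R ν φ (γ t)) := by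
  intro t ht
  obtain ⟨hz, hd⟩ := hγ t ht
  refine ⟨R_mem_leaf hJ hν hz φ, ?_⟩
  rw [← fderiv_R_redField hk hsmooth hsymp hJ hν hH hHinv hz φ]
  exact (differentiableAt_R hsmooth hz φ).hasFDerivAt.comp_hasDerivWithinAt t hd

/-- Noether's theorem for the reduced system. -/
theorem fderiv_JW_redField [FiniteDimensional ℝ E] (hk : Module.finrank ℝ E = 2 * k + 8)
    (hsmooth : IsSmoothAction E M) (hJ : IsEquivariantMomentumMap Ω J) (hν : IsVertical ν)
    (hH : ContMDiff 𝓘(ℝ, E) 𝓘(ℝ, ℝ) ∞ H) (hHinv : ∀ (g : SymGroup) (x : M), H (g • x) = H x)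
    (hz : z ∈ C.leaf ν) : fderiv ℝ (C.JW ν) z (C.redField H ν z) = 0 := by
  have hR : DifferentiableAt ℝ (fun t : ℝ => C.R ν (t : Real.Angle) z) 0 :=
    (hsmooth.hasDerivAt_diag (mdifferentiableAt_of_contMDiffOn_U C.smooth_w
      (C.point_mem 0 0 _ _ hz))).differentiableAt
  have h0 : C.R ν ((0 : ℝ) : Real.Angle) z = z := by rw [Real.Angle.coe_zero, R_zero hz]
  have hd : HasFDerivAt (C.redH H ν) (fderiv ℝ (C.redH H ν) z)
      (C.R ν ((0 : ℝ) : Real.Angle) z) := by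
    rw [h0]; exact (differentiableAt_comp_point hH hz).hasFDerivAt
  have h1 := hd.comp_hasDerivAt 0 hR.hasDerivAt
  have h2 : HasDerivAt (C.redH H ν ∘ fun t : ℝ => C.R ν (t : Real.Angle) z) 0 0 := by
    rw [show (C.redH H ν ∘ fun t : ℝ => C.R ν (t : Real.Angle) z) = fun _ => C.redH H ν z from
      funext fun t => redH_R hk hsmooth hJ hν hHinv hz _]
    exact hasDerivAt_const _ _
  -- By antisymmetry the derivative of `J_W` along the reduced field is minus that of `H` along the
  -- circle orbit, where `H` is constant.
  rw [← formW_deriv_R hk hsmooth hJ hν hz, formW_swap, redField, formW_structJ, h1.unique h2,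
    neg_zero]

theorem IsReducedSolution.JW_eq [FiniteDimensional ℝ E] (hk : Module.finrank ℝ E = 2 * k + 8)
    (hsmooth : IsSmoothAction E M) (hJ : IsEquivariantMomentumMap Ω J) (hν : IsVertical ν)
    (hH : ContMDiff 𝓘(ℝ, E) 𝓘(ℝ, ℝ) ∞ H) (hHinv : ∀ (g : SymGroup) (x : M), H (g • x) = H x)
    {I : Set ℝ} (hI : I.OrdConnected) {γ : ℝ → WSpace k} (hγ : C.IsReducedSolution H ν I γ)
    {s t : ℝ} (hs : s ∈ I) (ht : t ∈ I) : C.JW ν (γ s) = C.JW ν (γ t) := by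
  have hd : ∀ r ∈ I, HasDerivWithinAt (fun r => C.JW ν (γ r)) 0 I r := fun r hr => by
    rw [← fderiv_JW_redField hk hsmooth hJ hν hH hHinv (hγ r hr).1]
    exact (differentiableAt_comp_point hJ.contMDiff_Jdiag
      (hγ r hr).1).hasFDerivAt.comp_hasDerivWithinAt r (hγ r hr).2
  -- The mean value inequality with bound `0` needs only derivatives within `I`, so endpoints are
  -- allowed.
  have h := hI.convex.norm_image_sub_le_of_norm_hasDerivWithin_le (C := 0) hd
    (fun r _ => by simp) ht hs
  rw [zero_mul, norm_le_zero_iff, sub_eq_zero] at h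
  exact h

end Dynamics

end ReductionCoordinates

end

theorem mainTheorem9
    {E : Type*} [NormedAddCommGroup E] [NormedSpace ℝ E] [FiniteDimensional ℝ E]
    {M : Type*} [TopologicalSpace M] [T2Space M] [SecondCountableTopology M]
    [ConnectedSpace M] [ChartedSpace E M] [IsManifold 𝓘(ℝ, E) ∞ M]
    (Ω : ∀ x : M, TangentSpace 𝓘(ℝ, E) x [⋀^Fin 2]→L[ℝ] ℝ) (hΩ : IsSymplecticForm Ω)
    [MulAction SymGroup M] [ProperSMul SymGroup M] [FaithfulSMul SymGroup M]
    (hsmooth : IsSmoothAction E M) (hsymp : PreservesForm Ω)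
    (H : M → ℝ) (hH : ContMDiff 𝓘(ℝ, E) 𝓘(ℝ, ℝ) ∞ H)
    (hHinv : ∀ (g : SymGroup) (x : M), H (g • x) = H x)
    (J : M → Module.Dual ℝ SymLie) (hJ : IsEquivariantMomentumMap Ω J)
    (xe : M) (hxe : IsRelativeEquilibrium Ω H xe) (haxi : IsAxisymmetric xe)
    (k : ℕ) (hk : Module.finrank ℝ E = 2 * k + 8)
    (C : ReductionCoordinates Ω J xe k)
    (ν : Momenta) (hν : IsVertical ν) :
    -- `R_φ(ν, ·)` is a circle action on `W`, and it is the action induced by `SO(2)_D`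
    IsCircleAction (C.leaf ν) (C.R ν) ∧
    (∀ (φ : Real.Angle) (b : E3) (ψ : Real.Angle), ∀ z ∈ C.leaf ν,
      Jtranslation J (SymGroup.diag φ • C.point b ψ ν z) = ν.1 ∧
      Jspin J (SymGroup.diag φ • C.point b ψ ν z) = ν.2 ∧
      C.w (SymGroup.diag φ • C.point b ψ ν z) = C.R ν φ z) ∧
    -- it is symplectic, with momentum map `J_W`
    IsSymplecticOn (C.leaf ν) (C.R ν) ∧
    IsCircleMomentumMap (C.leaf ν) (C.R ν) (C.JW ν) ∧
    -- the reduced system is `SO(2)_D`-symmetric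
    (∀ φ, ∀ z ∈ C.leaf ν, C.redH H ν (C.R ν φ z) = C.redH H ν z) ∧
    (∀ φ, ∀ z ∈ C.leaf ν,
      fderiv ℝ (C.R ν φ) z (C.redField H ν z) = C.redField H ν (C.R ν φ z)) ∧
    (∀ φ (I : Set ℝ) (γ : ℝ → WSpace k), I.OrdConnected → C.IsReducedSolution H ν I γ →
      C.IsReducedSolution H ν I (fun t => C.R ν φ (γ t))) ∧
    -- the reduced system conserves `J_W`
    (∀ (I : Set ℝ) (γ : ℝ → WSpace k), I.OrdConnected → C.IsReducedSolution H ν I γ →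
      ∀ s ∈ I, ∀ t ∈ I, C.JW ν (γ s) = C.JW ν (γ t)) := by
  have hw := fun (φ : Real.Angle) (b : E3) (ψ : Real.Angle) (z : WSpace k) (hz : z ∈ C.leaf ν) =>
    ReductionCoordinates.w_diag_smul_point hk hsmooth hJ hz φ b ψ
  have hm := fun (φ : Real.Angle) (b : E3) (ψ : Real.Angle) (z : WSpace k) (hz : z ∈ C.leaf ν) =>
    ReductionCoordinates.shiftMomenta_diag_smul_point hJ hν hz φ b ψ
  refine ⟨⟨C.isOpen_leaf ν, fun φ z hz => ReductionCoordinates.R_mem_leaf hJ hν hz φ,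
    fun z hz => ReductionCoordinates.R_zero hz,
    fun φ ψ z hz => ReductionCoordinates.R_add hk hsmooth hJ hν hz φ ψ,
    ReductionCoordinates.contDiffOn_R_uncurried hsmooth⟩,
    fun φ b ψ z hz => ⟨congrArg Prod.fst (hm φ b ψ z hz), congrArg Prod.snd (hm φ b ψ z hz),
      hw φ b ψ z hz⟩,
    fun φ z hz => ReductionCoordinates.formW_fderiv_R hk hsmooth hsymp hJ hν hz φ,
    ⟨ReductionCoordinates.contDiffOn_comp_point hJ.contMDiff_Jdiag,
      fun z hz => ReductionCoordinates.formW_deriv_R hk hsmooth hJ hν hz⟩,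
    fun φ z hz => ReductionCoordinates.redH_R hk hsmooth hJ hν hHinv hz φ,
    fun φ z hz => ReductionCoordinates.fderiv_R_redField hk hsmooth hsymp hJ hν hH hHinv hz φ,
    fun φ I γ _ hγ => hγ.map_R hk hsmooth hsymp hJ hν hH hHinv φ,
    fun I γ hI hγ s hs t ht => hγ.JW_eq hk hsmooth hJ hν hH hHinv hI hs ht⟩
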